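/- For positive integers $r,s,t$ let \[ R(r,s,t)=\sum_{u,v=1}^\infty\frac{(-1)^v}{u^r v^s (u+v)^t},\qquad S(r,s,t)=\sum_{u,v=1}^\infty\frac{(-1)^{u+v}}{u^r v^s (u+v)^t}, \] and let $\zeta$ be the Riemann zeta function. These double series converge absolutely for all positive integers $r,s,t$, and the following evaluations hold: \begin{align*} R(1,1,1)&=-\tfrac{5}{8}\zeta(3),\\ R(1,1,3)&=\tfrac{1}{16}\pi^2\zeta(3)-\tfrac{27}{32}\zeta(5),\\ R(1,2,2)&=\tfrac{5}{48}\pi^2\zeta(3)-\tfrac{3}{2}\zeta(5),\\ R(1,3,1)&=\tfrac{1}{12}\pi^2\zeta(3)-\tfrac{59}{32}\zeta(5),\\ R(2,1,2)&=-\tfrac{5}{16}\pi^2\zeta(3)+\tfrac{107}{32}\zeta(5),\\ R(2,2,1)&=-\tfrac{5}{24}\pi^2\zeta(3)+\tfrac{59}{32}\zeta(5),\\ R(3,1,1)&=\tfrac{1}{8}\pi^2\zeta(3)-\tfrac{59}{32}\zeta(5),\\ S(5,5,5)&=\tfrac{7}{73728}\pi^4\zeta(11)+\tfrac{35}{24576}\pi^2\zeta(13)+\tfrac{63}{8192}\zeta(15),\\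 S(7,7,7)&=\tfrac{31}{35389440}\pi^6\zeta(15)+\tfrac{49}{1966080}\pi^4\zeta(17)+\tfrac{77}{262144}\pi^2\zeta(19)+\tfrac{429}{262144}\zeta(21),\\ R(5,5,5)&=\tfrac{16375}{147456}\pi^4\zeta(11)+\tfrac{573335}{49152}\pi^2\zeta(13)-\tfrac{2064195}{16384}\zeta(15),\\ R(7,7,7)&=\tfrac{1048543}{70778880}\pi^6\zeta(15)+\tfrac{7339969}{3932160}\pi^4\zeta(17)+\tfrac{80740121}{524288}\pi^2\zeta(19)-\tfrac{899676921}{524288}\zeta(21),\\ R(9,9,9)&=\tfrac{13421747}{7046430720}\pi^8\zeta(19)+\tfrac{738197141}{2113929216}\pi^6\zeta(21)+\tfrac{1919313253}{67108864}\pi^4\zeta(23)+\tfrac{143948506845}{67108864}\pi^2\zeta(25)-\tfrac{1631416447375}{67108864}\zeta(27). \end{align*} -/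

import Mathlib

noncomputable section

/-- The `(u, v)` term `(-1)^v / (u^r v^s (u+v)^t)` of the alternating Tornheim series `R(r,s,t)`. -/
def tornheimRTerm (r s t : ℕ) (p : ℕ+ × ℕ+) : ℝ :=
  (-1) ^ (p.2 : ℕ) /
    (((p.1 : ℕ) : ℝ) ^ r * ((p.2 : ℕ) : ℝ) ^ s * (((p.1 : ℕ) : ℝ) + ((p.2 : ℕ) : ℝ)) ^ t)

/-- The `(u, v)` term `(-1)^(u+v) / (u^r v^s (u+v)^t)` of the alternating Tornheim series
`S(r,s,t)`. -/
def tornheimSTerm (r s t : ℕ) (p : ℕ+ × ℕ+) : ℝ :=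
  (-1) ^ ((p.1 : ℕ) + (p.2 : ℕ)) /
    (((p.1 : ℕ) : ℝ) ^ r * ((p.2 : ℕ) : ℝ) ^ s * (((p.1 : ℕ) : ℝ) + ((p.2 : ℕ) : ℝ)) ^ t)

/-- `R(r,s,t) = ∑_{u,v ≥ 1} (-1)^v / (u^r v^s (u+v)^t)`. -/
def tornheimR (r s t : ℕ) : ℝ := ∑' p : ℕ+ × ℕ+, tornheimRTerm r s t p

/-- `S(r,s,t) = ∑_{u,v ≥ 1} (-1)^(u+v) / (u^r v^s (u+v)^t)`. -/
def tornheimS (r s t : ℕ) : ℝ := ∑' p : ℕ+ × ℕ+, tornheimSTerm r s t p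

end

/-!
For signs `a, b = ±1` consider the summand `f(u, v) = a^u b^v / (u^r v^s (u+v)^t)` on the
lattice of pairs of integers, set to zero on the lines `u = 0`, `v = 0`, `u + v = 0`. It is
absolutely summable (`summable_latticeTerm`): among `|u|, |v|, |u + v|` the largest is at least
the geometric mean of the other two `x, y`, so that `|f| ≤ (x y)^(-3/2)`.

If the weight `r + s + t` is odd, then `f(-u, -v) = -f(u, v)`. The half planes `u > 0` and
`v > 0` both contain the positive quadrant, whose sum is the Tornheim series, and their remaining
quadrants are exchanged by `(u, v) ↦ (-u, -v)` and so cancel. Hence twice the Tornheim series is the sum of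
the two half plane sums (`two_mul_tornheimSum`).

A half plane sum reduces to single zeta values (`halfPlaneSum_eq_sum`). For fixed `u`, expand
`1 / (v^s (u+v)^t)` in partial fractions in `v` (`inv_pow_mul_inv_pow_partialFraction`) and sum
over all integers `v`, in symmetric intervals. Each `∑ b^v / v^k` is then zero for odd `k`, by
oddness, and `2 ∑_{n ≥ 1} b^n / n^k` for even `k` (`tendsto_sum_twistedInvPow`); its translate
by `u` only acquires a sign (`tendsto_sum_Icc_shift`). Symmetric summation is what deals with
the conditionally convergent terms `k = 1`. What is left is a sum over `u` of terms `a^u / u^m`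
and `(ab)^u / u^m`.

As the weight is odd, every product of two zeta values that occurs has one even argument, at
most `8` in the cases at hand, and Euler's formula turns it into a power of `π`; the alternating
values are `∑ (-1)^n / n^k = (2^(1-k) - 1) ζ(k)` (`twistedZeta_neg_one`).
-/

open Finset Filter Topology

/-! ### A partial fraction expansion -/

/-- Partial fractions of `1 / (x y^(q+1))` with respect to `u = y - x`. -/
lemma inv_mul_inv_pow_partialFraction {x y : ℝ} (hx : x ≠ 0) (hy : y ≠ 0) (hxy : y - x ≠ 0)
    (q : ℕ) :
    1 / (x * y ^ (q + 1)) = 1 / (x * (y - x) ^ (q + 1)) -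
      ∑ i ∈ range (q + 1), 1 / (y ^ (q + 1 - i) * (y - x) ^ (1 + i)) := by
  induction q with
  | zero => simp; field_simp
  | succ q ih =>
    have h : 1 / (x * y ^ (q + 1 + 1)) =
        (1 / (x * y ^ (q + 1)) - 1 / y ^ (q + 2)) / (y - x) := by
      field_simp
      ring
    rw [h, ih, sum_range_succ' _ (q + 1), sub_div, sub_div, sum_div]
    have h2 : ∀ i ∈ range (q + 1), 1 / (y ^ (q + 1 + 1 - (i + 1)) * (y - x) ^ (1 + (i + 1))) =
        1 / (y ^ (q + 1 - i) * (y - x) ^ (1 + i)) / (y - x) := by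
      intro i _
      rw [Nat.add_sub_add_right, ← add_assoc, pow_succ _ (1 + i)]
      field_simp
    rw [sum_congr rfl h2, Nat.sub_zero, add_zero]
    field_simp
    ring

/-- Partial fractions of `1 / (x^(p+1) y^(q+1))` with respect to `u = y - x`. -/
lemma inv_pow_mul_inv_pow_partialFraction {x y : ℝ} (hx : x ≠ 0) (hy : y ≠ 0) (hxy : y - x ≠ 0)
    (p q : ℕ) :
    1 / (x ^ (p + 1) * y ^ (q + 1)) =
      ∑ i ∈ range (p + 1), (-1) ^ i * ((i + q).choose q : ℝ) /
        (x ^ (p + 1 - i) * (y - x) ^ (q + 1 + i)) +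
      (-1) ^ (p + 1) * ∑ i ∈ range (q + 1), ((i + p).choose p : ℝ) /
        (y ^ (q + 1 - i) * (y - x) ^ (p + 1 + i)) := by
  induction p generalizing q with
  | zero =>
    have := inv_mul_inv_pow_partialFraction hx hy hxy q
    simp only [zero_add, pow_one, range_one, sum_singleton, pow_zero, Nat.choose_self, add_zero,
      Nat.choose_zero_right, Nat.cast_one, one_mul, Nat.sub_zero]
    linarith
  | succ p ihp =>
    induction q with
    | zero =>
      have h : 1 / (x ^ (p + 1 + 1) * y ^ (0 + 1)) =
          (1 / x ^ (p + 2) - 1 / (x ^ (p + 1) * y ^ (0 + 1))) / (y - x) := by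
        field_simp
        ring
      rw [h, ihp, sum_range_succ' _ (p + 1), sub_div, add_div, sum_div]
      have h2 : ∀ i ∈ range (p + 1), (-1) ^ (i + 1) * ((i + 1 + 0).choose 0 : ℝ) /
            (x ^ (p + 1 + 1 - (i + 1)) * (y - x) ^ (0 + 1 + (i + 1))) =
          -((-1) ^ i * ((i + 0).choose 0 : ℝ) /
            (x ^ (p + 1 - i) * (y - x) ^ (0 + 1 + i)) / (y - x)) := by
        intro i _
        rw [Nat.add_sub_add_right, ← add_assoc, pow_succ _ (0 + 1 + i)]
        simp
        field_simp
        ring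
      rw [sum_congr rfl h2, sum_neg_distrib]
      simp
      field_simp
      ring
    | succ q ihq =>
      have h : 1 / (x ^ (p + 1 + 1) * y ^ (q + 1 + 1)) =
          (1 / (x ^ (p + 1 + 1) * y ^ (q + 1)) - 1 / (x ^ (p + 1) * y ^ (q + 1 + 1))) /
            (y - x) := by
        field_simp
        ring
      have hc : ∀ m k : ℕ, ((m + 1 + (k + 1)).choose (k + 1) : ℝ) =
          (m + 1 + k).choose k + (m + (k + 1)).choose (k + 1) := by
        intro m k
        rw [show m + 1 + (k + 1) = (m + 1 + k) + 1 by ring, Nat.choose_succ_succ,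
          show m + 1 + k = m + (k + 1) by ring]
        push_cast; ring
      have hA : ∑ i ∈ range (p + 1 + 1), (-1) ^ i * ((i + (q + 1)).choose (q + 1) : ℝ) /
            (x ^ (p + 1 + 1 - i) * (y - x) ^ (q + 1 + 1 + i)) =
          (∑ i ∈ range (p + 1 + 1), (-1) ^ i * ((i + q).choose q : ℝ) /
            (x ^ (p + 1 + 1 - i) * (y - x) ^ (q + 1 + i)) -
           ∑ i ∈ range (p + 1), (-1) ^ i * ((i + (q + 1)).choose (q + 1) : ℝ) /
            (x ^ (p + 1 - i) * (y - x) ^ (q + 1 + 1 + i))) / (y - x) := by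
        rw [sum_range_succ' _ (p + 1), sum_range_succ' _ (p + 1), add_sub_right_comm,
          ← sum_sub_distrib, add_div, sum_div]
        congr 1
        · refine sum_congr rfl fun i _ => ?_
          rw [hc, Nat.add_sub_add_right]
          rw [show q + 1 + (i + 1) = q + 1 + 1 + i by ring,
            show q + 1 + 1 + (i + 1) = q + 1 + 1 + i + 1 by ring, pow_succ (y - x)]
          field_simp
          ring
        · simp
          field_simp
          ring
      have hB : ∑ i ∈ range (q + 1 + 1), ((i + (p + 1)).choose (p + 1) : ℝ) /
            (y ^ (q + 1 + 1 - i) * (y - x) ^ (p + 1 + 1 + i)) =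
          (∑ i ∈ range (q + 1 + 1), ((i + p).choose p : ℝ) /
            (y ^ (q + 1 + 1 - i) * (y - x) ^ (p + 1 + i)) +
           ∑ i ∈ range (q + 1), ((i + (p + 1)).choose (p + 1) : ℝ) /
            (y ^ (q + 1 - i) * (y - x) ^ (p + 1 + 1 + i))) / (y - x) := by
        rw [sum_range_succ' _ (q + 1), sum_range_succ' _ (q + 1), add_right_comm _ _ (∑ i ∈ _, _),
          ← sum_add_distrib, add_div, sum_div]
        congr 1
        · refine sum_congr rfl fun i _ => ?_
          rw [hc, Nat.add_sub_add_right]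
          rw [show p + 1 + (i + 1) = p + 1 + 1 + i by ring,
            show p + 1 + 1 + (i + 1) = p + 1 + 1 + i + 1 by ring, pow_succ (y - x)]
          field_simp
        · simp
          field_simp
          ring
      rw [h, ihq, ihp, hA, hB, pow_succ _ (p + 1)]
      ring

/-! ### Alternating power sums over the integers -/

/-- The function `n ↦ a^n / n^k` on the integers, used with `a = ±1` and `k ≥ 1`. By the
convention `1 / 0 = 0` it vanishes at `n = 0` when `k ≥ 1`. -/
noncomputable def twistedInvPow (a : ℝ) (k : ℕ) (n : ℤ) : ℝ := a ^ n / (n : ℝ) ^ k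

/-- The sum `∑_{n ≥ 1} a^n / n^k`, used with `a = ±1` and `k ≥ 2`. -/
noncomputable def twistedZeta (a : ℝ) (k : ℕ) : ℝ := ∑' n : ℕ+, twistedInvPow a k (n : ℤ)

/-- The value of the sum of `a^n / n^k` over the nonzero integers `n`, taken symmetrically:
it vanishes for odd `k`, and is `2 ∑_{n ≥ 1} a^n / n^k` for even `k`. -/
noncomputable def twistedZetaInt (a : ℝ) (k : ℕ) : ℝ := if Even k then 2 * twistedZeta a k else 0

lemma ne_zero_of_sq_eq_one {a : ℝ} (ha : a ^ 2 = 1) : a ≠ 0 := by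
  rintro rfl; norm_num at ha

lemma abs_zpow_of_sq_eq_one {a : ℝ} (ha : a ^ 2 = 1) (n : ℤ) : |a ^ n| = 1 := by
  rw [abs_zpow, (pow_eq_one_iff_of_nonneg (abs_nonneg a) two_ne_zero).1 (by rw [sq_abs, ha]),
    one_zpow]

lemma zpow_neg_of_sq_eq_one {a : ℝ} (ha : a ^ 2 = 1) (n : ℤ) : a ^ (-n) = a ^ n := by
  have h : a⁻¹ = a := by
    have := ne_zero_of_sq_eq_one ha
    field_simp
    exact ha.symm
  rw [← inv_zpow', h]

lemma twistedInvPow_neg {a : ℝ} (ha : a ^ 2 = 1) (k : ℕ) (n : ℤ) :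
    twistedInvPow a k (-n) = (-1) ^ k * twistedInvPow a k n := by
  unfold twistedInvPow
  rw [zpow_neg_of_sq_eq_one ha, Int.cast_neg, neg_pow, div_mul_eq_div_div,
    div_eq_mul_inv (a ^ n) ((-1) ^ k), ← inv_pow, inv_neg_one]
  ring

lemma twistedInvPow_zero (a : ℝ) {k : ℕ} (hk : k ≠ 0) : twistedInvPow a k 0 = 0 := by
  simp [twistedInvPow, hk]

lemma abs_twistedInvPow {a : ℝ} (ha : a ^ 2 = 1) (k : ℕ) (n : ℤ) :
    |twistedInvPow a k n| = 1 / |(n : ℝ)| ^ k := by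
  rw [twistedInvPow, abs_div, abs_zpow_of_sq_eq_one ha, abs_pow]

lemma summable_twistedInvPow {a : ℝ} (ha : a ^ 2 = 1) {k : ℕ} (hk : 1 < k) :
    Summable (twistedInvPow a k) := by
  refine Summable.of_norm ?_
  have h := (Real.summable_one_div_int_pow (p := k)).2 hk
  refine h.abs.congr fun n => ?_
  rw [Real.norm_eq_abs, abs_twistedInvPow ha, abs_div, abs_pow, abs_one]

lemma tendsto_twistedInvPow_cofinite {a : ℝ} (ha : a ^ 2 = 1) {k : ℕ} (hk : k ≠ 0) :
    Tendsto (twistedInvPow a k) cofinite (𝓝 0) := by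
  have h1 : Tendsto (fun n : ℤ => |(n : ℝ)|) cofinite atTop := by
    rw [Int.cofinite_eq]
    exact tendsto_sup.2 ⟨tendsto_abs_atBot_atTop.comp (tendsto_intCast_atBot_iff.2 tendsto_id),
      tendsto_abs_atTop_atTop.comp tendsto_intCast_atTop_atTop⟩
  rw [tendsto_zero_iff_abs_tendsto_zero]
  have h2 := ((tendsto_pow_atTop hk).comp h1).inv_tendsto_atTop
  refine h2.congr fun n => ?_
  simp [abs_twistedInvPow ha]

lemma tendsto_Icc_neg_atTop :
    Tendsto (fun N : ℕ => Icc (-(N : ℤ)) N) atTop atTop := by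
  refine tendsto_atTop_finset_of_monotone (fun M N h => Icc_subset_Icc (by simpa) (by simpa)) ?_
  intro n
  exact ⟨n.natAbs, by rw [mem_Icc]; omega⟩

/-- For `k = 1` the sum over the integers converges only in the symmetric sense used here. -/
lemma tendsto_sum_twistedInvPow {a : ℝ} (ha : a ^ 2 = 1) {k : ℕ} (hk : k ≠ 0) :
    Tendsto (fun N : ℕ => ∑ n ∈ Icc (-(N : ℤ)) N, twistedInvPow a k n) atTop
      (𝓝 (twistedZetaInt a k)) := by
  rcases Nat.even_or_odd k with he | ho
  · have h1 : 1 < k := by rcases he with ⟨m, rfl⟩; omega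
    have hs := summable_twistedInvPow ha h1
    have hsum : ∑' n, twistedInvPow a k n = twistedZetaInt a k := by
      rw [tsum_int_eq_zero_add_two_mul_tsum_pnat _ hs, twistedInvPow_zero a hk,
        twistedZetaInt, if_pos he, twistedZeta]
      · simp
      · intro n
        rw [twistedInvPow_neg ha, he.neg_one_pow, one_mul]
    rw [← hsum]
    exact hs.hasSum.comp tendsto_Icc_neg_atTop
  · rw [twistedZetaInt, if_neg (Nat.not_even_iff_odd.2 ho)]
    refine tendsto_const_nhds.congr fun N => ?_
    have h : ∑ n ∈ Icc (-(N : ℤ)) N, twistedInvPow a k n =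
        ∑ n ∈ Icc (-(N : ℤ)) N, -twistedInvPow a k n := by
      refine sum_equiv (Equiv.neg ℤ) (fun n => ?_) fun n _ => ?_
      · simp only [mem_Icc, Equiv.neg_apply]; omega
      · rw [Equiv.neg_apply, twistedInvPow_neg ha, ho.neg_one_pow]; ring
    rw [sum_neg_distrib] at h
    linarith

/-- Symmetric summation over the integers is insensitive to translation, for functions which tend
to zero. -/
lemma tendsto_sum_Icc_shift {g : ℤ → ℝ} {l : ℝ} (hg : Tendsto g cofinite (𝓝 0))
    (h : Tendsto (fun N : ℕ => ∑ n ∈ Icc (-(N : ℤ)) N, g n) atTop (𝓝 l)) (m : ℕ) :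
    Tendsto (fun N : ℕ => ∑ n ∈ Icc (-(N : ℤ)) N, g (n + m)) atTop (𝓝 l) := by
  induction m with
  | zero => simpa using h
  | succ m ih =>
    have hstep : ∀ N : ℕ, ∑ n ∈ Icc (-(N : ℤ)) N, g (n + m) +
        (g (N + 1 + m) - g (-N + m)) = ∑ n ∈ Icc (-(N : ℤ)) N, g (n + (m + 1 : ℕ)) := by
      intro N
      have h1 : ∑ n ∈ Icc (-(N : ℤ)) N, g (n + (m + 1 : ℕ)) =
          ∑ n ∈ Icc (-(N : ℤ) + 1) (N + 1), g (n + m) := by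
        refine sum_equiv (Equiv.addRight 1) (fun n => ?_) fun n _ => ?_
        · simp
        · simp only [Equiv.coe_addRight]; congr 1; push_cast; ring
      have h2 : insert (-(N : ℤ)) (Icc (-(N : ℤ) + 1) (N + 1)) =
          insert ((N : ℤ) + 1) (Icc (-(N : ℤ)) N) := by
        ext n; simp only [mem_insert, mem_Icc]; omega
      have h3 := congrArg (fun s => ∑ n ∈ s, g (n + m)) h2
      rw [sum_insert (by simp), sum_insert (by simp)] at h3
      rw [h1]; linarith
    have ht1 : Tendsto (fun N : ℕ => g (N + 1 + m)) atTop (𝓝 0) := by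
      refine hg.comp (Nat.cofinite_eq_atTop ▸ Function.Injective.tendsto_cofinite ?_)
      intro x y hxy; simpa using hxy
    have ht2 : Tendsto (fun N : ℕ => g (-N + m)) atTop (𝓝 0) := by
      refine hg.comp (Nat.cofinite_eq_atTop ▸ Function.Injective.tendsto_cofinite ?_)
      intro x y hxy; simpa using hxy
    have := (ih.add (ht1.sub ht2)).congr hstep
    simpa using this

/-! ### The Tornheim summand on the integer lattice -/

/-- The summand `a^u b^v / (u^r v^s (u+v)^t)` of the Tornheim series with signs `a, b = ±1`, as a
function on the lattice of pairs of integers. For positive `r, s, t` it vanishes on the lines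
`u = 0`, `v = 0` and `u + v = 0`, by the convention `1 / 0 = 0`. -/
noncomputable def latticeTerm (a b : ℝ) (r s t : ℕ) (u v : ℤ) : ℝ :=
  a ^ u * b ^ v / ((u : ℝ) ^ r * (v : ℝ) ^ s * ((u : ℝ) + (v : ℝ)) ^ t)

lemma latticeTerm_swap (a b : ℝ) (r s t : ℕ) (u v : ℤ) :
    latticeTerm a b r s t u v = latticeTerm b a s r t v u := by
  unfold latticeTerm
  rw [mul_comm (a ^ u), mul_comm ((u : ℝ) ^ r), add_comm (u : ℝ)]

lemma latticeTerm_neg_neg {a b : ℝ} (ha : a ^ 2 = 1) (hb : b ^ 2 = 1) {r s t : ℕ}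
    (h : Odd (r + s + t)) (u v : ℤ) :
    latticeTerm a b r s t (-u) (-v) = -latticeTerm a b r s t u v := by
  unfold latticeTerm
  have h1 : ((-u : ℤ) : ℝ) ^ r * ((-v : ℤ) : ℝ) ^ s * (((-u : ℤ) : ℝ) + ((-v : ℤ) : ℝ)) ^ t =
      -((u : ℝ) ^ r * (v : ℝ) ^ s * ((u : ℝ) + (v : ℝ)) ^ t) := by
    have h2 : ((-1 : ℝ) ^ r * (-1) ^ s * (-1) ^ t) = -1 := by
      rw [← pow_add, ← pow_add, h.neg_one_pow]
    rw [Int.cast_neg, Int.cast_neg, ← neg_add, neg_pow, neg_pow (v : ℝ), neg_pow (_ + _)]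
    linear_combination ((u : ℝ) ^ r * (v : ℝ) ^ s * ((u : ℝ) + (v : ℝ)) ^ t) * h2
  rw [zpow_neg_of_sq_eq_one ha, zpow_neg_of_sq_eq_one hb, h1, div_neg]

lemma inv_mul_mul_le_rpow {x y z : ℝ} (hx : 0 < x) (hy : 0 < y) (hxz : x ≤ z) (hyz : y ≤ z) :
    1 / (x * y * z) ≤ x ^ (-(3 / 2) : ℝ) * y ^ (-(3 / 2) : ℝ) := by
  have hz : 0 < z := hx.trans_le hxz
  have h : ∀ w : ℝ, 0 < w → w ^ (-(3 / 2) : ℝ) = 1 / w * w ^ (-(1 / 2) : ℝ) := by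
    intro w hw
    rw [one_div, ← Real.rpow_neg_one, ← Real.rpow_add hw]
    norm_num
  have hzz : 1 / z = z ^ (-(1 / 2) : ℝ) * z ^ (-(1 / 2) : ℝ) := by
    rw [one_div, ← Real.rpow_neg_one, ← Real.rpow_add hz]
    norm_num
  rw [h x hx, h y hy]
  have hx' := Real.rpow_le_rpow_of_nonpos hx hxz (show (-(1 / 2) : ℝ) ≤ 0 by norm_num)
  have hy' := Real.rpow_le_rpow_of_nonpos hy hyz (show (-(1 / 2) : ℝ) ≤ 0 by norm_num)
  calc 1 / (x * y * z) = 1 / x * (1 / y) * (1 / z) := by field_simp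
    _ = 1 / x * (1 / y) * (z ^ (-(1 / 2) : ℝ) * z ^ (-(1 / 2) : ℝ)) := by rw [hzz]
    _ ≤ 1 / x * (1 / y) * (x ^ (-(1 / 2) : ℝ) * y ^ (-(1 / 2) : ℝ)) := by gcongr
    _ = _ := by ring

/-- Comparing the largest of `x, y, z` with the other two bounds `1 / (x y z)` by a sum of functions
of two of the three variables which are summable over the lattice. -/
lemma inv_mul_mul_le_sum_rpow {x y z : ℝ} (hx : 0 < x) (hy : 0 < y) (hz : 0 < z) :
    1 / (x * y * z) ≤ x ^ (-(3 / 2) : ℝ) * y ^ (-(3 / 2) : ℝ) +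
      x ^ (-(3 / 2) : ℝ) * z ^ (-(3 / 2) : ℝ) + y ^ (-(3 / 2) : ℝ) * z ^ (-(3 / 2) : ℝ) := by
  have h1 : 0 ≤ x ^ (-(3 / 2) : ℝ) * y ^ (-(3 / 2) : ℝ) := by positivity
  have h2 : 0 ≤ x ^ (-(3 / 2) : ℝ) * z ^ (-(3 / 2) : ℝ) := by positivity
  have h3 : 0 ≤ y ^ (-(3 / 2) : ℝ) * z ^ (-(3 / 2) : ℝ) := by positivity
  rcases le_total x z with hxz | hzx
  · rcases le_total y z with hyz | hzy
    · linarith [inv_mul_mul_le_rpow hx hy hxz hyz]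
    · have := inv_mul_mul_le_rpow hx hz (hxz.trans hzy) hzy
      rw [mul_right_comm] at this
      linarith
  · rcases le_total x y with hxy | hyx
    · have := inv_mul_mul_le_rpow hx hz hxy (hzx.trans hxy)
      rw [mul_right_comm] at this
      linarith
    · have := inv_mul_mul_le_rpow hy hz hyx hzx
      rw [mul_comm, ← mul_assoc] at this
      linarith

/-- The Tornheim summand is absolutely summable over the whole lattice, off its singular lines. -/
lemma summable_latticeTerm {a b : ℝ} (ha : a ^ 2 = 1) (hb : b ^ 2 = 1) {r s t : ℕ}
    (hr : r ≠ 0) (hs : s ≠ 0) (ht : t ≠ 0) :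
    Summable fun p : ℤ × ℤ => latticeTerm a b r s t p.1 p.2 := by
  have hA := Real.summable_abs_int_rpow (b := 3 / 2) (by norm_num)
  have hAA := Summable.mul_of_nonneg hA hA (fun n => by positivity) (fun n => by positivity)
  -- the two shears of the lattice replacing one coordinate by the sum `u + v`
  have hAB := ((Equiv.prodShear (Equiv.refl ℤ) (fun u => Equiv.addLeft u)).summable_iff).2 hAA
  have hBA := ((Equiv.prodComm ℤ ℤ).summable_iff).2 hAB
  refine Summable.of_norm_bounded ((hAA.add hAB).add hBA) fun p => ?_
  obtain ⟨u, v⟩ := p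
  simp only [Function.comp_apply, Equiv.prodShear_apply, Equiv.refl_apply, Equiv.coe_addLeft,
    Equiv.prodComm_apply, Prod.swap_prod_mk]
  rw [Real.norm_eq_abs, latticeTerm, abs_div, abs_mul, abs_zpow_of_sq_eq_one ha,
    abs_zpow_of_sq_eq_one hb, abs_mul, abs_mul, abs_pow, abs_pow, abs_pow, add_comm v u, mul_one]
  push_cast
  by_cases hu : u = 0
  · simp only [hu, Int.cast_zero, abs_zero, zero_pow hr, zero_mul, div_zero]; positivity
  by_cases hv : v = 0
  · simp only [hv, Int.cast_zero, abs_zero, zero_pow hs, zero_mul, mul_zero, div_zero]; positivity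
  by_cases hw : u + v = 0
  · have : (u : ℝ) + v = 0 := by exact_mod_cast hw
    simp only [this, abs_zero, zero_pow ht, mul_zero, div_zero]; positivity
  have key : ∀ n : ℤ, n ≠ 0 → (1 : ℝ) ≤ |(n : ℝ)| := by
    intro n hn
    exact_mod_cast Int.one_le_abs hn
  have hu1 := key u hu
  have hv1 := key v hv
  have hw1 := key (u + v) hw
  push_cast at hw1
  refine le_trans ?_ (inv_mul_mul_le_sum_rpow (by linarith : 0 < |(u : ℝ)|)
    (by linarith : 0 < |(v : ℝ)|) (by linarith : 0 < |(u : ℝ) + v|))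
  have hu2 := le_self_pow₀ hu1 hr
  have hv2 := le_self_pow₀ hv1 hs
  have hw2 := le_self_pow₀ hw1 ht
  gcongr

/-- The sum of the Tornheim summand over the positive quadrant. -/
noncomputable def tornheimSum (a b : ℝ) (r s t : ℕ) : ℝ :=
  ∑' p : ℕ+ × ℕ+, latticeTerm a b r s t p.1 p.2

/-- The sum of the Tornheim summand over the half plane `u > 0`. -/
noncomputable def halfPlaneSum (a b : ℝ) (r s t : ℕ) : ℝ :=
  ∑' u : ℕ+, ∑' v : ℤ, latticeTerm a b r s t u v

lemma summable_latticeTerm_right {a b : ℝ} (ha : a ^ 2 = 1) (hb : b ^ 2 = 1) {r s t : ℕ}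
    (hr : r ≠ 0) (hs : s ≠ 0) (ht : t ≠ 0) (u : ℤ) : Summable (latticeTerm a b r s t u) :=
  (summable_latticeTerm ha hb hr hs ht).prod_factor u

lemma summable_latticeTerm_pnat {a b : ℝ} (ha : a ^ 2 = 1) (hb : b ^ 2 = 1) {r s t : ℕ}
    (hr : r ≠ 0) (hs : s ≠ 0) (ht : t ≠ 0) :
    Summable fun p : ℕ+ × ℕ+ => latticeTerm a b r s t p.1 p.2 :=
  (summable_latticeTerm ha hb hr hs ht).comp_injective
    (i := fun p : ℕ+ × ℕ+ => ((p.1 : ℤ), (p.2 : ℤ))) fun p q h => by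
      simpa [Prod.ext_iff] using h

lemma tornheimSum_swap (a b : ℝ) (r s t : ℕ) : tornheimSum a b r s t = tornheimSum b a s r t := by
  unfold tornheimSum
  rw [← (Equiv.prodComm ℕ+ ℕ+).tsum_eq]
  exact tsum_congr fun p => latticeTerm_swap ..

/-- The half plane is the union of two quadrants (and a line where the summand vanishes). -/
lemma halfPlaneSum_eq {a b : ℝ} (ha : a ^ 2 = 1) (hb : b ^ 2 = 1) {r s t : ℕ}
    (hr : r ≠ 0) (hs : s ≠ 0) (ht : t ≠ 0) :
    halfPlaneSum a b r s t = tornheimSum a b r s t +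
      ∑' p : ℕ+ × ℕ+, latticeTerm a b r s t p.1 (-p.2) := by
  have h1 := summable_latticeTerm_pnat ha hb hr hs ht
  have h2 : Summable fun p : ℕ+ × ℕ+ => latticeTerm a b r s t p.1 (-p.2) :=
    (summable_latticeTerm ha hb hr hs ht).comp_injective
      (i := fun p : ℕ+ × ℕ+ => ((p.1 : ℤ), -(p.2 : ℤ))) fun p q h => by
      simpa [Prod.ext_iff] using h
  rw [tornheimSum, h1.tsum_prod, h2.tsum_prod, ← h1.prod.tsum_add h2.prod, halfPlaneSum]
  refine tsum_congr fun u => ?_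
  rw [tsum_int_eq_zero_add_tsum_pnat (summable_latticeTerm_right ha hb hr hs ht u)]
  simp [latticeTerm, hs]

/-- For odd weight `r + s + t` the summand is odd, so that in the sum over the half planes `u > 0`
and `v > 0` the contributions of the quadrants `u > 0 > v` and `v > 0 > u` cancel. -/
lemma two_mul_tornheimSum {a b : ℝ} (ha : a ^ 2 = 1) (hb : b ^ 2 = 1) {r s t : ℕ}
    (hr : r ≠ 0) (hs : s ≠ 0) (ht : t ≠ 0) (hodd : Odd (r + s + t)) :
    2 * tornheimSum a b r s t = halfPlaneSum a b r s t + halfPlaneSum b a s r t := by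
  have h : ∑' p : ℕ+ × ℕ+, latticeTerm b a s r t p.1 (-p.2) =
      -∑' p : ℕ+ × ℕ+, latticeTerm a b r s t p.1 (-p.2) := by
    rw [← tsum_neg, ← (Equiv.prodComm ℕ+ ℕ+).tsum_eq]
    refine tsum_congr fun p => ?_
    simp only [Equiv.prodComm_apply, Prod.fst_swap, Prod.snd_swap]
    rw [latticeTerm_swap, ← latticeTerm_neg_neg ha hb hodd, neg_neg]
  rw [halfPlaneSum_eq ha hb hr hs ht, halfPlaneSum_eq hb ha hs hr ht, h, tornheimSum_swap b a]
  ring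

/-! ### Evaluation of the half plane sums -/

lemma sum_range_choose_cast (m k : ℕ) :
    ∑ i ∈ range (m + 1), ((i + k).choose k : ℝ) = ((m + k + 1).choose (k + 1) : ℝ) := by
  exact_mod_cast Nat.sum_range_add_choose m k

/-- The partial fraction expansion of the summand in `v`. The last two terms are corrections on the
lines `v = 0` and `u + v = 0`, where the summand vanishes but the expansion does not. -/
lemma latticeTerm_partialFraction (a : ℝ) {b : ℝ} (hb : b ^ 2 = 1) (r p q : ℕ)
    {u : ℤ} (hu : u ≠ 0) (v : ℤ) :
    latticeTerm a b r (p + 1) (q + 1) u v =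
      ∑ i ∈ range (p + 1), (-1) ^ i * ((i + q).choose q : ℝ) *
        twistedInvPow a (r + q + 1 + i) u * twistedInvPow b (p + 1 - i) v +
      ∑ i ∈ range (q + 1), (-1) ^ (p + 1) * ((i + p).choose p : ℝ) *
        twistedInvPow (a * b) (r + p + 1 + i) u * twistedInvPow b (q + 1 - i) (v + u) -
      ((if v = 0 then (-1) ^ (p + 1) * ((q + p + 1).choose (p + 1) : ℝ) *
          twistedInvPow a (r + p + q + 2) u else 0) +
        (if v = -u then (-1) ^ (p + 1) * ((p + q + 1).choose (q + 1) : ℝ) *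
          twistedInvPow (a * b) (r + p + q + 2) u else 0)) := by
  have hb0 := ne_zero_of_sq_eq_one hb
  have hur : (u : ℝ) ≠ 0 := by exact_mod_cast hu
  have hbb : ∀ n : ℤ, b ^ n * b ^ n = 1 := by
    intro n
    rw [← mul_zpow, ← sq, hb, one_zpow]
  by_cases hv : v = 0
  · subst hv
    have h0 : (0 : ℤ) ≠ -u := by simpa [eq_comm] using hu
    rw [if_pos rfl, if_neg h0, sum_eq_zero fun i hi => ?_]
    · rw [← sum_range_choose_cast, mul_sum, sum_mul, zero_add, add_zero, ← sum_sub_distrib,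
        sum_eq_zero fun i hi => ?_]
      · simp [latticeTerm]
      · have hi' := mem_range.1 hi
        unfold twistedInvPow
        rw [zero_add, mul_zpow, show r + p + q + 2 = (r + p + 1 + i) + (q + 1 - i) by omega,
          pow_add (u : ℝ) (r + p + 1 + i)]
        field_simp
        linear_combination (-1) ^ p * a ^ u * ((i + p).choose p : ℝ) * (-hbb u)
    · have hi' := mem_range.1 hi
      rw [twistedInvPow_zero b (by omega), mul_zero]
  by_cases hv' : v = -u
  · subst hv'
    rw [if_neg hv, if_pos rfl, add_comm (∑ i ∈ range (p + 1), _), sum_eq_zero fun i hi => ?_]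
    · rw [← sum_range_choose_cast, mul_sum, sum_mul, zero_add, zero_add, ← sum_sub_distrib,
        sum_eq_zero fun i hi => ?_]
      · simp [latticeTerm]
      · have hi' := mem_range.1 hi
        rw [twistedInvPow_neg hb]
        unfold twistedInvPow
        rw [mul_zpow, show r + p + q + 2 = (r + q + 1 + i) + (p + 1 - i) by omega,
          show (-1 : ℝ) ^ (p + 1) = (-1) ^ i * (-1) ^ (p + 1 - i) by
            rw [← pow_add]; congr 1; omega,
          pow_add (u : ℝ) (r + q + 1 + i)]
        field_simp
        ring
    · have hi' := mem_range.1 hi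
      rw [neg_add_cancel, twistedInvPow_zero b (by omega), mul_zero]
  have hvr : (v : ℝ) ≠ 0 := by exact_mod_cast hv
  have hw : (v : ℝ) + u ≠ 0 := by
    intro h
    apply hv'
    have : v + u = 0 := by exact_mod_cast h
    omega
  have hpf := inv_pow_mul_inv_pow_partialFraction hvr hw (by simpa using hur) p q
  rw [if_neg hv, if_neg hv', add_zero, sub_zero]
  have hL : latticeTerm a b r (p + 1) (q + 1) u v =
      a ^ u * b ^ v / (u : ℝ) ^ r * (1 / ((v : ℝ) ^ (p + 1) * ((v : ℝ) + u) ^ (q + 1))) := by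
    unfold latticeTerm
    rw [add_comm (u : ℝ)]
    field_simp
  rw [hL, hpf, mul_add, mul_sum, mul_sum, mul_sum]
  congr 1
  · refine sum_congr rfl fun i _ => ?_
    unfold twistedInvPow
    rw [add_sub_cancel_left, show r + q + 1 + i = r + (q + 1 + i) by ring, pow_add (u : ℝ) r]
    field_simp
  · refine sum_congr rfl fun i _ => ?_
    unfold twistedInvPow
    rw [add_sub_cancel_left, show r + p + 1 + i = r + (p + 1 + i) by ring, pow_add (u : ℝ) r,
      mul_zpow, zpow_add₀ hb0, Int.cast_add]
    field_simp
    rw [sq, hbb u, mul_one]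

lemma mul_self_sq_eq_one {a b : ℝ} (ha : a ^ 2 = 1) (hb : b ^ 2 = 1) : (a * b) ^ 2 = 1 := by
  rw [mul_pow, ha, hb, one_mul]

/-- The sum of the Tornheim summand over `v`, for fixed `u ≥ 1`. -/
lemma tsum_latticeTerm_right {a b : ℝ} (ha : a ^ 2 = 1) (hb : b ^ 2 = 1) {r : ℕ} (hr : r ≠ 0)
    (p q : ℕ) (u : ℕ+) :
    ∑' v : ℤ, latticeTerm a b r (p + 1) (q + 1) u v =
      ∑ i ∈ range (p + 1), (-1) ^ i * ((i + q).choose q : ℝ) *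
        twistedZetaInt b (p + 1 - i) * twistedInvPow a (r + q + 1 + i) u +
      ∑ i ∈ range (q + 1), (-1) ^ (p + 1) * ((i + p).choose p : ℝ) *
        twistedZetaInt b (q + 1 - i) * twistedInvPow (a * b) (r + p + 1 + i) u -
      ((-1) ^ (p + 1) * ((q + p + 1).choose (p + 1) : ℝ) * twistedInvPow a (r + p + q + 2) u +
        (-1) ^ (p + 1) * ((p + q + 1).choose (q + 1) : ℝ) *
          twistedInvPow (a * b) (r + p + q + 2) u) := by
  have hsum := (summable_latticeTerm_right ha hb hr p.succ_ne_zero q.succ_ne_zero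
    (u : ℤ)).hasSum.comp tendsto_Icc_neg_atTop
  refine tendsto_nhds_unique hsum ?_
  have hu : ((u : ℕ) : ℤ) ≠ 0 := by simp
  have h1 : ∀ k, k ≠ 0 → Tendsto (fun N : ℕ => ∑ v ∈ Icc (-(N : ℤ)) N, twistedInvPow b k v) atTop
      (𝓝 (twistedZetaInt b k)) := fun k hk => tendsto_sum_twistedInvPow hb hk
  have h2 : ∀ k, k ≠ 0 → Tendsto (fun N : ℕ => ∑ v ∈ Icc (-(N : ℤ)) N,
      twistedInvPow b k (v + (u : ℕ))) atTop (𝓝 (twistedZetaInt b k)) := fun k hk =>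
    tendsto_sum_Icc_shift (tendsto_twistedInvPow_cofinite hb hk) (h1 k hk) u
  have h3 : ∀ (n : ℤ) (c : ℝ), Tendsto (fun N : ℕ => ∑ v ∈ Icc (-(N : ℤ)) N,
      if v = n then c else 0) atTop (𝓝 c) := fun n c =>
    (hasSum_ite_eq n c).comp tendsto_Icc_neg_atTop
  -- the symmetric partial sums of the partial fraction expansion, term by term
  have hlim := ((tendsto_finsetSum (range (p + 1)) fun i hi =>
      (h1 (p + 1 - i) (by have := mem_range.1 hi; omega)).const_mul
        ((-1) ^ i * ((i + q).choose q : ℝ) * twistedInvPow a (r + q + 1 + i) u)).add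
    (tendsto_finsetSum (range (q + 1)) fun i hi =>
      (h2 (q + 1 - i) (by have := mem_range.1 hi; omega)).const_mul
        ((-1) ^ (p + 1) * ((i + p).choose p : ℝ) *
          twistedInvPow (a * b) (r + p + 1 + i) u))).sub
    ((h3 0 ((-1) ^ (p + 1) * ((q + p + 1).choose (p + 1) : ℝ) *
        twistedInvPow a (r + p + q + 2) u)).add
      (h3 (-u) ((-1) ^ (p + 1) * ((p + q + 1).choose (q + 1) : ℝ) *
        twistedInvPow (a * b) (r + p + q + 2) u)))
  have hval : ∀ (n : ℕ) (c d e : ℕ → ℝ), ∑ i ∈ range n, c i * d i * e i =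
      ∑ i ∈ range n, c i * e i * d i := fun n c d e =>
    sum_congr rfl fun i _ => mul_right_comm ..
  rw [hval (p + 1) (fun i => (-1) ^ i * ((i + q).choose q : ℝ)),
    hval (q + 1) (fun i => (-1) ^ (p + 1) * ((i + p).choose p : ℝ))]
  refine hlim.congr fun N => ?_
  simp only [mul_sum, Function.comp_apply]
  rw [sum_comm, sum_comm (s := range (q + 1)), ← sum_add_distrib, ← sum_add_distrib,
    ← sum_sub_distrib]
  exact sum_congr rfl fun v _ => (latticeTerm_partialFraction a hb r p q hu v).symm

/-- The half plane sum as a polynomial in single zeta values and alternating zeta values. -/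
lemma halfPlaneSum_eq_sum {a b : ℝ} (ha : a ^ 2 = 1) (hb : b ^ 2 = 1) {r : ℕ} (hr : r ≠ 0)
    (p q : ℕ) :
    halfPlaneSum a b r (p + 1) (q + 1) =
      ∑ i ∈ range (p + 1), (-1) ^ i * ((i + q).choose q : ℝ) *
        twistedZetaInt b (p + 1 - i) * twistedZeta a (r + q + 1 + i) +
      ∑ i ∈ range (q + 1), (-1) ^ (p + 1) * ((i + p).choose p : ℝ) *
        twistedZetaInt b (q + 1 - i) * twistedZeta (a * b) (r + p + 1 + i) -
      ((-1) ^ (p + 1) * ((q + p + 1).choose (p + 1) : ℝ) * twistedZeta a (r + p + q + 2) +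
        (-1) ^ (p + 1) * ((p + q + 1).choose (q + 1) : ℝ) *
          twistedZeta (a * b) (r + p + q + 2)) := by
  have hz : ∀ c : ℝ, c ^ 2 = 1 → ∀ k : ℕ, 1 < k →
      HasSum (fun u : ℕ+ => twistedInvPow c k u) (twistedZeta c k) := by
    intro c hc k hk
    refine Summable.hasSum ((summable_twistedInvPow hc hk).comp_injective
      (i := fun u : ℕ+ => (u : ℤ)) fun m n h => by simpa using h)
  have hab := mul_self_sq_eq_one ha hb
  rw [halfPlaneSum, tsum_congr (tsum_latticeTerm_right ha hb hr p q)]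
  refine HasSum.tsum_eq (((hasSum_sum fun i _ => ?_).add (hasSum_sum fun i _ => ?_)).sub
    (HasSum.add ?_ ?_))
  · exact (hz a ha _ (by omega)).mul_left _
  · exact (hz _ hab _ (by omega)).mul_left _
  · exact (hz a ha _ (by omega)).mul_left _
  · exact (hz _ hab _ (by omega)).mul_left _

/-! ### Values of the single sums -/

lemma twistedZeta_eq_tsum_nat (a : ℝ) {k : ℕ} (hk : 1 < k) :
    twistedZeta a k = ∑' n : ℕ, a ^ n / (n : ℝ) ^ k := by
  have h := tsum_pnat_eq_tsum_of_eq_zero (f := fun n : ℕ => twistedInvPow a k n)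
    (twistedInvPow_zero a (by omega))
  rw [twistedZeta, h]
  exact tsum_congr fun n => by simp [twistedInvPow]

/-- The alternating zeta value, obtained by separating even and odd terms. -/
lemma twistedZeta_neg_one {k : ℕ} (hk : 1 < k) :
    twistedZeta (-1) k = (2 * (1 / 2) ^ k - 1) * twistedZeta 1 k := by
  have hs : Summable fun n : ℕ => 1 / (n : ℝ) ^ k := Real.summable_one_div_nat_pow.2 hk
  have hs2 : Summable fun n : ℕ => 1 / ((2 * n : ℕ) : ℝ) ^ k :=
    hs.comp_injective (i := fun n : ℕ => 2 * n) fun m n h => by simpa using h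
  have hs1 : Summable fun n : ℕ => 1 / ((2 * n + 1 : ℕ) : ℝ) ^ k :=
    hs.comp_injective (i := fun n : ℕ => 2 * n + 1) fun m n h => by simpa using h
  have hE : ∑' n : ℕ, 1 / ((2 * n : ℕ) : ℝ) ^ k = (1 / 2) ^ k * ∑' n : ℕ, 1 / (n : ℝ) ^ k := by
    rw [← tsum_mul_left]
    refine tsum_congr fun n => ?_
    push_cast
    rw [mul_pow, one_div_pow, one_div_mul_one_div]
  have h1 := tsum_even_add_odd (f := fun n : ℕ => 1 / (n : ℝ) ^ k) hs2 hs1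
  have h2 := tsum_even_add_odd (f := fun n : ℕ => (-1 : ℝ) ^ n / (n : ℝ) ^ k)
    (by simpa using hs2) (by simpa [pow_add, neg_div] using hs1.neg)
  have h3 : ∑' n : ℕ, (-1 : ℝ) ^ (2 * n) / ((2 * n : ℕ) : ℝ) ^ k =
      ∑' n : ℕ, 1 / ((2 * n : ℕ) : ℝ) ^ k := by simp
  have h4 : ∑' n : ℕ, (-1 : ℝ) ^ (2 * n + 1) / ((2 * n + 1 : ℕ) : ℝ) ^ k =
      -∑' n : ℕ, 1 / ((2 * n + 1 : ℕ) : ℝ) ^ k := by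
    rw [← tsum_neg]
    exact tsum_congr fun n => by simp [pow_add, neg_div]
  rw [twistedZeta_eq_tsum_nat _ hk, twistedZeta_eq_tsum_nat _ hk]
  simp only [one_pow]
  linarith

lemma riemannZeta_eq_twistedZeta {k : ℕ} (hk : 1 < k) :
    riemannZeta k = (twistedZeta 1 k : ℂ) := by
  rw [zeta_nat_eq_tsum_of_gt_one hk, twistedZeta_eq_tsum_nat _ hk]
  push_cast
  simp

lemma twistedZeta_one_two_mul {k : ℕ} (hk : k ≠ 0) :
    twistedZeta 1 (2 * k) = (-1 : ℝ) ^ (k + 1) * (2 : ℝ) ^ (2 * k - 1) * Real.pi ^ (2 * k) *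
        bernoulli (2 * k) / (Nat.factorial (2 * k)) := by
  rw [twistedZeta_eq_tsum_nat _ (by omega), ← (hasSum_zeta_nat hk).tsum_eq]
  simp

lemma twistedZeta_one_two : twistedZeta 1 2 = Real.pi ^ 2 / 6 := by
  have h := twistedZeta_one_two_mul one_ne_zero
  rw [bernoulli_eq_bernoulli'_of_ne_one (by norm_num), mul_one, bernoulli'_two] at h
  norm_num at h
  linarith

lemma twistedZeta_one_four : twistedZeta 1 4 = Real.pi ^ 4 / 90 := by
  have h := twistedZeta_one_two_mul two_ne_zero
  rw [bernoulli_eq_bernoulli'_of_ne_one (by norm_num), bernoulli'_four] at h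
  norm_num [Nat.factorial] at h
  linarith

lemma bernoulli'_six : bernoulli' 6 = 1 / 42 := by
  have h5 : bernoulli' 5 = 0 := bernoulli'_eq_zero_of_odd (by decide) (by norm_num)
  rw [bernoulli'_def]
  norm_num [sum_range_succ, h5, Nat.choose]

lemma bernoulli'_eight : bernoulli' 8 = -1 / 30 := by
  have h5 : bernoulli' 5 = 0 := bernoulli'_eq_zero_of_odd (by decide) (by norm_num)
  have h7 : bernoulli' 7 = 0 := bernoulli'_eq_zero_of_odd (by decide) (by norm_num)
  rw [bernoulli'_def]
  norm_num [sum_range_succ, h5, bernoulli'_six, h7, Nat.choose]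

lemma twistedZeta_one_six : twistedZeta 1 6 = Real.pi ^ 6 / 945 := by
  have h := twistedZeta_one_two_mul three_ne_zero
  rw [bernoulli_eq_bernoulli'_of_ne_one (by norm_num), bernoulli'_six] at h
  norm_num [Nat.factorial] at h
  linarith

lemma twistedZeta_one_eight : twistedZeta 1 8 = Real.pi ^ 8 / 9450 := by
  have h := twistedZeta_one_two_mul four_ne_zero
  rw [bernoulli_eq_bernoulli'_of_ne_one (by norm_num), bernoulli'_eight] at h
  norm_num [Nat.factorial] at h
  linarith

/-! ### The alternating Tornheim series -/

lemma tornheimRTerm_eq (r s t : ℕ) (p : ℕ+ × ℕ+) :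
    tornheimRTerm r s t p = latticeTerm 1 (-1) r s t p.1 p.2 := by
  simp [tornheimRTerm, latticeTerm]

lemma tornheimSTerm_eq (r s t : ℕ) (p : ℕ+ × ℕ+) :
    tornheimSTerm r s t p = latticeTerm (-1) (-1) r s t p.1 p.2 := by
  simp [tornheimSTerm, latticeTerm, pow_add]

lemma two_mul_tornheimR (r s t : ℕ) (h : Odd (r + 1 + (s + 1) + (t + 1))) :
    2 * tornheimR (r + 1) (s + 1) (t + 1) = halfPlaneSum 1 (-1) (r + 1) (s + 1) (t + 1) +
      halfPlaneSum (-1) 1 (s + 1) (r + 1) (t + 1) := by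
  rw [← two_mul_tornheimSum (by norm_num) (by norm_num) r.succ_ne_zero s.succ_ne_zero
    t.succ_ne_zero h, tornheimR, tornheimSum, tsum_congr (tornheimRTerm_eq _ _ _)]

/-- For equal first two exponents the two half plane sums in `two_mul_tornheimSum` coincide. -/
lemma tornheimS_eq_halfPlaneSum (r t : ℕ) (h : Odd (r + 1 + (r + 1) + (t + 1))) :
    tornheimS (r + 1) (r + 1) (t + 1) = halfPlaneSum (-1) (-1) (r + 1) (r + 1) (t + 1) := by
  have := two_mul_tornheimSum (a := -1) (b := -1) (by norm_num) (by norm_num) r.succ_ne_zero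
    r.succ_ne_zero t.succ_ne_zero h
  rw [tornheimS, tsum_congr (tornheimSTerm_eq _ _ _)]
  rw [tornheimSum] at this
  linarith

/-- For odd weight, `R` as a polynomial in zeta values and alternating zeta values. -/
lemma two_mul_tornheimR_eq_sum (r s t : ℕ) (h : Odd (r + 1 + (s + 1) + (t + 1))) :
    2 * tornheimR (r + 1) (s + 1) (t + 1) =
      (∑ i ∈ range (s + 1), (-1) ^ i * ((i + t).choose t : ℝ) *
        twistedZetaInt (-1) (s + 1 - i) * twistedZeta 1 (r + 1 + t + 1 + i) +
      ∑ i ∈ range (t + 1), (-1) ^ (s + 1) * ((i + s).choose s : ℝ) *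
        twistedZetaInt (-1) (t + 1 - i) * twistedZeta (-1) (r + 1 + s + 1 + i) -
      ((-1) ^ (s + 1) * ((t + s + 1).choose (s + 1) : ℝ) * twistedZeta 1 (r + 1 + s + t + 2) +
        (-1) ^ (s + 1) * ((s + t + 1).choose (t + 1) : ℝ) *
          twistedZeta (-1) (r + 1 + s + t + 2))) +
      (∑ i ∈ range (r + 1), (-1) ^ i * ((i + t).choose t : ℝ) *
        twistedZetaInt 1 (r + 1 - i) * twistedZeta (-1) (s + 1 + t + 1 + i) +
      ∑ i ∈ range (t + 1), (-1) ^ (r + 1) * ((i + r).choose r : ℝ) *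
        twistedZetaInt 1 (t + 1 - i) * twistedZeta (-1) (s + 1 + r + 1 + i) -
      ((-1) ^ (r + 1) * ((t + r + 1).choose (r + 1) : ℝ) * twistedZeta (-1) (s + 1 + r + t + 2) +
        (-1) ^ (r + 1) * ((r + t + 1).choose (t + 1) : ℝ) *
          twistedZeta (-1) (s + 1 + r + t + 2))) := by
  rw [two_mul_tornheimR r s t h, halfPlaneSum_eq_sum (by norm_num) (by norm_num) (by simp),
    halfPlaneSum_eq_sum (by norm_num) (by norm_num) (by simp), one_mul, mul_one]

set_option maxHeartbeats 1000000 in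
theorem mainTheorem5 :
    (∀ r s t : ℕ, 0 < r → 0 < s → 0 < t →
      Summable (tornheimRTerm r s t) ∧ Summable (tornheimSTerm r s t)) ∧
    (tornheimR 1 1 1 : ℂ) =
      -(5 / 8) * riemannZeta 3 ∧
    (tornheimR 1 1 3 : ℂ) =
      (1 / 16) * (Real.pi : ℂ) ^ 2 * riemannZeta 3 - (27 / 32) * riemannZeta 5 ∧
    (tornheimR 1 2 2 : ℂ) =
      (5 / 48) * (Real.pi : ℂ) ^ 2 * riemannZeta 3 - (3 / 2) * riemannZeta 5 ∧
    (tornheimR 1 3 1 : ℂ) =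
      (1 / 12) * (Real.pi : ℂ) ^ 2 * riemannZeta 3 - (59 / 32) * riemannZeta 5 ∧
    (tornheimR 2 1 2 : ℂ) =
      -(5 / 16) * (Real.pi : ℂ) ^ 2 * riemannZeta 3 + (107 / 32) * riemannZeta 5 ∧
    (tornheimR 2 2 1 : ℂ) =
      -(5 / 24) * (Real.pi : ℂ) ^ 2 * riemannZeta 3 + (59 / 32) * riemannZeta 5 ∧
    (tornheimR 3 1 1 : ℂ) =
      (1 / 8) * (Real.pi : ℂ) ^ 2 * riemannZeta 3 - (59 / 32) * riemannZeta 5 ∧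
    (tornheimS 5 5 5 : ℂ) =
      (7 / 73728) * (Real.pi : ℂ) ^ 4 * riemannZeta 11 + (35 / 24576) * (Real.pi : ℂ) ^ 2 * riemannZeta 13
      + (63 / 8192) * riemannZeta 15 ∧
    (tornheimS 7 7 7 : ℂ) =
      (31 / 35389440) * (Real.pi : ℂ) ^ 6 * riemannZeta 15 + (49 / 1966080) * (Real.pi : ℂ) ^ 4 * riemannZeta 17
      + (77 / 262144) * (Real.pi : ℂ) ^ 2 * riemannZeta 19 + (429 / 262144) * riemannZeta 21 ∧
    (tornheimR 5 5 5 : ℂ) =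
      (16375 / 147456) * (Real.pi : ℂ) ^ 4 * riemannZeta 11 + (573335 / 49152) * (Real.pi : ℂ) ^ 2 * riemannZeta 13
      - (2064195 / 16384) * riemannZeta 15 ∧
    (tornheimR 7 7 7 : ℂ) =
      (1048543 / 70778880) * (Real.pi : ℂ) ^ 6 * riemannZeta 15 + (7339969 / 3932160) * (Real.pi : ℂ) ^ 4 * riemannZeta 17
      + (80740121 / 524288) * (Real.pi : ℂ) ^ 2 * riemannZeta 19 - (899676921 / 524288) * riemannZeta 21 ∧
    (tornheimR 9 9 9 : ℂ) =
      (13421747 / 7046430720) * (Real.pi : ℂ) ^ 8 * riemannZeta 19 + (738197141 / 2113929216) * (Real.pi : ℂ) ^ 6 * riemannZeta 21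
      + (1919313253 / 67108864) * (Real.pi : ℂ) ^ 4 * riemannZeta 23 + (143948506845 / 67108864) * (Real.pi : ℂ) ^ 2 * riemannZeta 25
      - (1631416447375 / 67108864) * riemannZeta 27 := by
  have hz : ∀ k : ℕ, 1 < k → riemannZeta k = (twistedZeta 1 k : ℂ) := fun k hk =>
    riemannZeta_eq_twistedZeta hk
  have h3 : riemannZeta 3 = (twistedZeta 1 3 : ℂ) := by simpa using hz 3 (by norm_num)
  have h5 : riemannZeta 5 = (twistedZeta 1 5 : ℂ) := by simpa using hz 5 (by norm_num)
  have h11 : riemannZeta 11 = (twistedZeta 1 11 : ℂ) := by simpa using hz 11 (by norm_num)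
  have h13 : riemannZeta 13 = (twistedZeta 1 13 : ℂ) := by simpa using hz 13 (by norm_num)
  have h15 : riemannZeta 15 = (twistedZeta 1 15 : ℂ) := by simpa using hz 15 (by norm_num)
  have h17 : riemannZeta 17 = (twistedZeta 1 17 : ℂ) := by simpa using hz 17 (by norm_num)
  have h19 : riemannZeta 19 = (twistedZeta 1 19 : ℂ) := by simpa using hz 19 (by norm_num)
  have h21 : riemannZeta 21 = (twistedZeta 1 21 : ℂ) := by simpa using hz 21 (by norm_num)
  have h23 : riemannZeta 23 = (twistedZeta 1 23 : ℂ) := by simpa using hz 23 (by norm_num)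
  have h25 : riemannZeta 25 = (twistedZeta 1 25 : ℂ) := by simpa using hz 25 (by norm_num)
  have h27 : riemannZeta 27 = (twistedZeta 1 27 : ℂ) := by simpa using hz 27 (by norm_num)
  -- all identities are proved between real numbers and then cast
  rw [h3, h5, h11, h13, h15, h17, h19, h21, h23, h25, h27]
  refine ⟨fun r s t hr hs ht => ⟨?_, ?_⟩, ?_, ?_, ?_, ?_, ?_, ?_, ?_, ?_, ?_, ?_, ?_, ?_⟩
  · exact (summable_latticeTerm_pnat (a := 1) (b := -1) (by norm_num) (by norm_num) hr.ne' hs.ne'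
      ht.ne').congr fun p => (tornheimRTerm_eq r s t p).symm
  · exact (summable_latticeTerm_pnat (a := -1) (b := -1) (by norm_num) (by norm_num) hr.ne' hs.ne'
      ht.ne').congr fun p => (tornheimSTerm_eq r s t p).symm
  · have h := two_mul_tornheimR_eq_sum 0 0 0 (by decide)
    norm_num [sum_range_succ, twistedZetaInt, Nat.choose, Nat.even_iff, twistedZeta_neg_one,
      twistedZeta_one_two, twistedZeta_one_four, twistedZeta_one_six, twistedZeta_one_eight] at h
    have hc := congrArg Complex.ofReal h
    push_cast at hc
    linear_combination (1 / 2) * hc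
  · have h := two_mul_tornheimR_eq_sum 0 0 2 (by decide)
    norm_num [sum_range_succ, twistedZetaInt, Nat.choose, Nat.even_iff, twistedZeta_neg_one,
      twistedZeta_one_two, twistedZeta_one_four, twistedZeta_one_six, twistedZeta_one_eight] at h
    have hc := congrArg Complex.ofReal h
    push_cast at hc
    linear_combination (1 / 2) * hc
  · have h := two_mul_tornheimR_eq_sum 0 1 1 (by decide)
    norm_num [sum_range_succ, twistedZetaInt, Nat.choose, Nat.even_iff, twistedZeta_neg_one,
      twistedZeta_one_two, twistedZeta_one_four, twistedZeta_one_six, twistedZeta_one_eight] at h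
    have hc := congrArg Complex.ofReal h
    push_cast at hc
    linear_combination (1 / 2) * hc
  · have h := two_mul_tornheimR_eq_sum 0 2 0 (by decide)
    norm_num [sum_range_succ, twistedZetaInt, Nat.choose, Nat.even_iff, twistedZeta_neg_one,
      twistedZeta_one_two, twistedZeta_one_four, twistedZeta_one_six, twistedZeta_one_eight] at h
    have hc := congrArg Complex.ofReal h
    push_cast at hc
    linear_combination (1 / 2) * hc
  · have h := two_mul_tornheimR_eq_sum 1 0 1 (by decide)
    norm_num [sum_range_succ, twistedZetaInt, Nat.choose, Nat.even_iff, twistedZeta_neg_one,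
      twistedZeta_one_two, twistedZeta_one_four, twistedZeta_one_six, twistedZeta_one_eight] at h
    have hc := congrArg Complex.ofReal h
    push_cast at hc
    linear_combination (1 / 2) * hc
  · have h := two_mul_tornheimR_eq_sum 1 1 0 (by decide)
    norm_num [sum_range_succ, twistedZetaInt, Nat.choose, Nat.even_iff, twistedZeta_neg_one,
      twistedZeta_one_two, twistedZeta_one_four, twistedZeta_one_six, twistedZeta_one_eight] at h
    have hc := congrArg Complex.ofReal h
    push_cast at hc
    linear_combination (1 / 2) * hc
  · have h := two_mul_tornheimR_eq_sum 2 0 0 (by decide)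
    norm_num [sum_range_succ, twistedZetaInt, Nat.choose, Nat.even_iff, twistedZeta_neg_one,
      twistedZeta_one_two, twistedZeta_one_four, twistedZeta_one_six, twistedZeta_one_eight] at h
    have hc := congrArg Complex.ofReal h
    push_cast at hc
    linear_combination (1 / 2) * hc
  · have h := tornheimS_eq_halfPlaneSum 4 4 (by decide)
    rw [halfPlaneSum_eq_sum (by norm_num) (by norm_num) (by norm_num)] at h
    norm_num [sum_range_succ, twistedZetaInt, Nat.choose, Nat.even_iff, twistedZeta_neg_one,
      twistedZeta_one_two, twistedZeta_one_four, twistedZeta_one_six, twistedZeta_one_eight] at h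
    have hc := congrArg Complex.ofReal h
    push_cast at hc
    linear_combination hc
  · have h := tornheimS_eq_halfPlaneSum 6 6 (by decide)
    rw [halfPlaneSum_eq_sum (by norm_num) (by norm_num) (by norm_num)] at h
    norm_num [sum_range_succ, twistedZetaInt, Nat.choose, Nat.even_iff, twistedZeta_neg_one,
      twistedZeta_one_two, twistedZeta_one_four, twistedZeta_one_six, twistedZeta_one_eight] at h
    have hc := congrArg Complex.ofReal h
    push_cast at hc
    linear_combination hc
  · have h := two_mul_tornheimR_eq_sum 4 4 4 (by decide)
    norm_num [sum_range_succ, twistedZetaInt, Nat.choose, Nat.even_iff, twistedZeta_neg_one,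
      twistedZeta_one_two, twistedZeta_one_four, twistedZeta_one_six, twistedZeta_one_eight] at h
    have hc := congrArg Complex.ofReal h
    push_cast at hc
    linear_combination (1 / 2) * hc
  · have h := two_mul_tornheimR_eq_sum 6 6 6 (by decide)
    norm_num [sum_range_succ, twistedZetaInt, Nat.choose, Nat.even_iff, twistedZeta_neg_one,
      twistedZeta_one_two, twistedZeta_one_four, twistedZeta_one_six, twistedZeta_one_eight] at h
    have hc := congrArg Complex.ofReal h
    push_cast at hc
    linear_combination (1 / 2) * hc
  · have h := two_mul_tornheimR_eq_sum 8 8 8 (by decide)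
    norm_num [sum_range_succ, twistedZetaInt, Nat.choose, Nat.even_iff, twistedZeta_neg_one,
      twistedZeta_one_two, twistedZeta_one_four, twistedZeta_one_six, twistedZeta_one_eight] at h
    have hc := congrArg Complex.ofReal h
    push_cast at hc
    linear_combination (1 / 2) * hc
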